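/- Let $R$ be a unital ring; modules are right $R$-modules. A Gabriel filter on $R$ is a nonempty collection $\mathcal F$ of right ideals such that, writing $(r:I)=\{s\in R \mid rs\in I\}$, (1) $I\in\mathcal F$ and $r\in R$ imply $(r:I)\in\mathcal F$; (2) if $I\in\mathcal F$ and $J$ is a right ideal with $(r:J)\in\mathcal F$ for all $r\in I$, then $J\in\mathcal F$. For a module $M$ let $T_{\mathcal F}(M)=\{m\in M \mid \mathrm{ann}(m)\in\mathcal F\}$; a module $N$ is $\mathcal F$-torsion if $T_{\mathcal F}(N)=N$. The module of quotients $M_{\mathcal F}$ is the largest submodule $N\supseteq M/T_{\mathcal F}(M)$ of the injective envelope of $M/T_{\mathcal F}(M)$ such that $N/(M/T_{\mathcal F}(M))$ is $\mathcal F$-torsion, and $q_{\mathcal F}:M\to M/T_{\mathcal F}(M)\to M_{\mathcal F}$ is the natural map. If $\mathcal F_1\subseteq\mathcal F_2$ are Gabriel filters, $q_{12}:M_{\mathcal F_1}\to M_{\mathcal F_2}$ denotes the unique $R$-linear map with $q_{12}\,q_{\mathcal F_1}=q_{\mathcal F_2}$. A higher derivation on $R$ is a family $\Delta=\{\delta_n\}_{n\ge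 0}$ of additive maps $R\to R$ with $\delta_0=\mathrm{id}$ and $\delta_n(rs)=\sum_{i=0}^n\delta_i(r)\delta_{n-i}(s)$ for all $n$, $r$, $s$. A $\Delta$-higher derivation on a module $M$ is a family $D=\{d_n\}_{n\ge 0}$ of additive maps $M\to M$ with $d_0=\mathrm{id}$ and $d_n(mr)=\sum_{i=0}^n d_i(m)\delta_{n-i}(r)$ for all $n$, $m$, $r$. An extension of $D$ to $M_{\mathcal F}$ is a $\Delta$-higher derivation $D'=\{d'_n\}$ on $M_{\mathcal F}$ with $d'_n q_{\mathcal F}=q_{\mathcal F} d_n$ for all $n$. Let $\Delta$ be a higher derivation on $R$. (a) Let $\mathcal F_1\subseteq\mathcal F_2$ be Gabriel filters on $R$, $M$ a module and $D$ a $\Delta$-higher derivation on $M$. Then $D$ has a unique extension $\{d^{(1)}_n\}$ to $M_{\mathcal F_1}$ and a unique extension $\{d^{(2)}_n\}$ to $M_{\mathcal F_2}$, and these agree: $q_{12}\,d^{(1)}_n=d^{(2)}_n\,q_{12}$ for all $n$. (b) Let $\tau$ be a hereditary torsion theory on right $R$-modules that is faithful (the largest torsion submodule of $R$ is $0$), and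 let $\mathcal F_\tau=\{I \mid R/I \text{ is torsion}\}$ be its Gabriel filter. Let $\mathcal F'$ be the Gabriel filter either of the Lambek torsion theory (torsion modules: those $T$ with $\mathrm{Hom}_R(T,E(R))=0$, where $E(R)$ is the injective envelope of $R$) or of the Goldie torsion theory (torsion-free modules: the nonsingular modules). Then $\mathcal F_\tau\subseteq\mathcal F'$, and for every module $M$ and every $\Delta$-higher derivation $D$ on $M$ the extensions of $D$ to $M_{\mathcal F_\tau}$ and to $M_{\mathcal F'}$ agree in the sense of (a). -/

import Mathlib

/-!
Conventions. Right modules over a ring `R` are `Rᵐᵒᵖ`-modules (`x r` is `MulOpposite.op r • x`) and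
right ideals of `R` are (left) ideals of `Rᵐᵒᵖ`. The general notions below are written for left
modules over a ring `A`; the right-sided notions over `R` are the case `A = Rᵐᵒᵖ`. In particular a
Gabriel filter of right ideals of `R` is an `F : IdealFilter Rᵐᵒᵖ` with `F.IsGabriel`, and
`F₁ ≤ F₂` is inclusion of filters.
-/

universe u v w

/-! ### Essential submodules and injective envelopes -/

section Envelope

/-- A submodule is essential if it meets every nonzero submodule nontrivially. -/
def Submodule.IsEssential {A : Type u} [Ring A] {M : Type v} [AddCommGroup M] [Module A M]
    (P : Submodule A M) : Prop :=
  ∀ Q : Submodule A M, Q ≠ ⊥ → P ⊓ Q ≠ ⊥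

theorem Submodule.isEssential_iff {A : Type u} [Ring A] {M : Type v} [AddCommGroup M] [Module A M]
    (P : Submodule A M) :
    P.IsEssential ↔ ∀ x : M, x ≠ 0 → ∃ a : A, a • x ≠ 0 ∧ a • x ∈ P := by
  constructor
  · intro h x hx
    have h1 := h (Submodule.span A {x}) (by simpa using hx)
    obtain ⟨y, hy, hy0⟩ := Submodule.exists_mem_ne_zero_of_ne_bot h1
    obtain ⟨a, rfl⟩ := Submodule.mem_span_singleton.1 hy.2
    exact ⟨a, hy0, hy.1⟩
  · intro h Q hQ hPQ
    obtain ⟨x, hx, hx0⟩ := Submodule.exists_mem_ne_zero_of_ne_bot hQ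
    obtain ⟨a, ha, haP⟩ := h x hx0
    have : a • x ∈ P ⊓ Q := ⟨haP, Q.smul_mem a hx⟩
    rw [hPQ] at this
    exact ha (by simpa using this)

/-- `ι : N → E` exhibits `E` as an injective envelope of `N`: `E` is an injective module and `ι` is
an essential monomorphism. -/
structure IsInjectiveEnvelope {A : Type u} [Ring A] {N : Type v} [AddCommGroup N] [Module A N]
    {E : Type w} [AddCommGroup E] [Module A E] (ι : N →ₗ[A] E) : Prop where
  mono : Function.Injective ι
  essential : (LinearMap.range ι).IsEssential
  isInjective : Module.Injective A E

theorem exists_injective_embedding (A : Type u) [Ring A] (N : Type v) [AddCommGroup N]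
    [Module A N] :
    ∃ (J : Type (max u v)) (_ : AddCommGroup J) (_ : Module A J) (f : N →ₗ[A] J),
      Module.Injective A J ∧ Function.Injective f := by
  have := ModuleCat.enoughInjectives.{v} A
  let X : ModuleCat.{max u v} A := ModuleCat.of A (ULift.{u} N)
  let J : ModuleCat.{max u v} A := CategoryTheory.Injective.under X
  let f : X ⟶ J := CategoryTheory.Injective.ι X
  have hf : Function.Injective f := (ModuleCat.mono_iff_injective f).1 inferInstance
  have hJ : CategoryTheory.Injective (ModuleCat.of A J) :=
    inferInstanceAs (CategoryTheory.Injective (CategoryTheory.Injective.under X))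
  refine ⟨J, inferInstance, inferInstance,
    f.hom ∘ₗ (ULift.moduleEquiv (R := A) (M := N)).symm.toLinearMap,
    Module.injective_module_of_injective_object A J, ?_⟩
  exact hf.comp (ULift.moduleEquiv (R := A) (M := N)).symm.injective

theorem exists_isInjectiveEnvelope (A : Type u) [Ring A] (N : Type v) [AddCommGroup N]
    [Module A N] :
    ∃ (E : Type (max u v)) (_ : AddCommGroup E) (_ : Module A E) (ι : N →ₗ[A] E),
      IsInjectiveEnvelope ι := by
  obtain ⟨J, _, _, f, hJ, hf⟩ := exists_injective_embedding A N
  let S : Set (Submodule A J) :=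
    {P | ∀ x ∈ P, x ≠ 0 → ∃ a : A, a • x ≠ 0 ∧ a • x ∈ LinearMap.range f}
  obtain ⟨E, hNE, hE⟩ := zorn_le_nonempty₀ S (fun c hc hch y hy => by
      refine ⟨sSup c, ?_, fun z hz => le_sSup hz⟩
      intro x hx hx0
      obtain ⟨P, hP, hxP⟩ := (Submodule.mem_sSup_of_directed ⟨y, hy⟩ hch.directedOn).1 hx
      exact hc hP x hxP hx0) (LinearMap.range f)
    (fun x hx hx0 => ⟨1, by simpa using hx0, by simpa using hx⟩)
  obtain ⟨C, -, hC⟩ := zorn_le_nonempty₀ {C : Submodule A J | ∀ x ∈ C, x ∈ E → x = 0}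
    (fun c hc hch y hy => by
      refine ⟨sSup c, ?_, fun z hz => le_sSup hz⟩
      intro x hx hxE
      obtain ⟨P, hP, hxP⟩ := (Submodule.mem_sSup_of_directed ⟨y, hy⟩ hch.directedOn).1 hx
      exact hc hP x hxP hxE) ⊥ (fun x hx _ => by simpa using hx)
  have hinj : Function.Injective (C.mkQ ∘ₗ E.subtype) := by
    rw [← LinearMap.ker_eq_bot, LinearMap.ker_eq_bot']
    intro x hx
    have : (x : J) ∈ C := by simpa using hx
    exact Subtype.ext (hC.prop _ this x.2)
  obtain ⟨g, hg⟩ := Module.Injective.extension_property A J E (J ⧸ C) (C.mkQ ∘ₗ E.subtype) hinj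
    E.subtype
  have hgE : ∀ x ∈ E, g (C.mkQ x) = x := fun x hx => LinearMap.congr_fun hg ⟨x, hx⟩
  -- `E` is essential in `J ⧸ C`
  have hess : ∀ x : J, x ∉ C → ∃ a : A, ∃ e ∈ E, e ≠ 0 ∧ C.mkQ (a • x) = C.mkQ e := by
    intro x hx
    by_contra hcon
    push Not at hcon
    have hmem : C ⊔ Submodule.span A {x} ∈ {C : Submodule A J | ∀ x ∈ C, x ∈ E → x = 0} := by
      intro y hy hyE
      obtain ⟨c, hc, z, hz, rfl⟩ := Submodule.mem_sup.1 hy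
      obtain ⟨a, rfl⟩ := Submodule.mem_span_singleton.1 hz
      by_contra h0
      refine hcon a _ hyE h0 ?_
      have : C.mkQ c = 0 := by simpa using hc
      rw [map_add, this, zero_add]
    have hle := hC.le_of_ge hmem le_sup_left
    exact hx (hle (Submodule.mem_sup_right (Submodule.mem_span_singleton_self x)))
  have hrange : LinearMap.range g ≤ E := by
    refine hE.le_of_ge ?_ (fun x hx => ⟨C.mkQ x, hgE x hx⟩)
    rintro _ ⟨y, rfl⟩ hy0
    obtain ⟨x, rfl⟩ := C.mkQ_surjective y
    have hxC : x ∉ C := by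
      intro hx
      apply hy0
      have : C.mkQ x = 0 := by simpa using hx
      rw [this, map_zero]
    obtain ⟨a, e, he, he0, hae⟩ := hess x hxC
    obtain ⟨b, hb0, hb⟩ := hE.prop e he he0
    refine ⟨b * a, ?_⟩
    have : (b * a) • g (C.mkQ x) = b • e := by
      rw [mul_smul, ← map_smul g, ← map_smul C.mkQ, hae, hgE e he]
    rw [this]
    exact ⟨hb0, hb⟩
  let r : J →ₗ[A] E := LinearMap.codRestrict E (g ∘ₗ C.mkQ) (fun x => hrange ⟨_, rfl⟩)
  have hr : ∀ x : E, r x = x := fun x => Subtype.ext (hgE x x.2)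
  refine ⟨E, inferInstance, inferInstance,
    LinearMap.codRestrict E f (fun x => hNE ⟨x, rfl⟩), ?_, ?_, ?_⟩
  · intro x y hxy
    exact hf (congrArg Subtype.val hxy)
  · rw [Submodule.isEssential_iff]
    intro x hx
    obtain ⟨a, ha, n, hn⟩ := hE.prop x x.2 (by simpa using hx)
    refine ⟨a, fun h => ha (by simpa using congrArg Subtype.val h), n, Subtype.ext hn⟩
  · constructor
    intro X Y _ _ _ _ i hi k
    obtain ⟨h, hh⟩ := Module.Injective.out i hi (E.subtype ∘ₗ k)
    refine ⟨r ∘ₗ h, fun x => ?_⟩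
    rw [LinearMap.comp_apply, hh]
    exact hr (k x)

variable (A : Type u) [Ring A] (N : Type v) [AddCommGroup N] [Module A N]

/-- The injective envelope `E(N)` of a module `N`. -/
def InjectiveEnvelope : Type (max u v) := (exists_isInjectiveEnvelope A N).choose

noncomputable instance : AddCommGroup (InjectiveEnvelope A N) :=
  (exists_isInjectiveEnvelope A N).choose_spec.choose

noncomputable instance : Module A (InjectiveEnvelope A N) :=
  (exists_isInjectiveEnvelope A N).choose_spec.choose_spec.choose

/-- The embedding of a module in its injective envelope. -/
noncomputable def InjectiveEnvelope.ι : N →ₗ[A] InjectiveEnvelope A N :=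
  (exists_isInjectiveEnvelope A N).choose_spec.choose_spec.choose_spec.choose

theorem InjectiveEnvelope.isInjectiveEnvelope :
    IsInjectiveEnvelope (InjectiveEnvelope.ι A N) :=
  (exists_isInjectiveEnvelope A N).choose_spec.choose_spec.choose_spec.choose_spec

instance : Module.Injective A (InjectiveEnvelope A N) :=
  (InjectiveEnvelope.isInjectiveEnvelope A N).isInjective

end Envelope

/-! ### Torsion submodule and module of quotients of a Gabriel filter -/

namespace IdealFilter

variable {A : Type u} [Ring A]

theorem isTorsionElem_iff (F : IdealFilter A) {M : Type v} [AddCommGroup M] [Module A M] (m : M) :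
    F.IsTorsionElem m ↔ (⊥ : Submodule A M).colon {m} ∈ F := by
  constructor
  · rintro ⟨L, hL, h⟩
    exact Order.PFilter.mem_of_le (fun a ha => by simpa using h a ha) hL
  · intro h
    exact ⟨_, h, fun a ha => by simpa using ha⟩

/-- The largest torsion submodule `T(M)` of `M`, consisting of all `m` with `ann(m) ∈ F`. -/
def torsionSubmodule (F : IdealFilter A) [F.IsGabriel] (M : Type v) [AddCommGroup M]
    [Module A M] : Submodule A M where
  carrier := {m | F.IsTorsionElem m}
  zero_mem' := by
    obtain ⟨L, hL⟩ := F.nonempty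
    exact ⟨L, hL, fun a _ => smul_zero a⟩
  add_mem' := by
    rintro x y ⟨L, hL, hx⟩ ⟨K, hK, hy⟩
    refine ⟨L ⊓ K, F.inf_mem hL hK, fun a ha => ?_⟩
    rw [smul_add, hx a ha.1, hy a ha.2, add_zero]
  smul_mem' := by
    rintro b x ⟨L, hL, hx⟩
    refine ⟨L.colon {b}, IsUniform.colon_mem hL b, fun a ha => ?_⟩
    rw [← mul_smul]
    exact hx _ (by simpa using ha)

variable (F : IdealFilter A) [F.IsGabriel] (M : Type v) [AddCommGroup M] [Module A M]

/-- The torsion-free quotient `M / T(M)` embedded in its injective envelope, as a submodule. -/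
noncomputable def envelopeBase :
    Submodule A (InjectiveEnvelope A (M ⧸ F.torsionSubmodule M)) :=
  LinearMap.range (InjectiveEnvelope.ι A (M ⧸ F.torsionSubmodule M))

/-- The closure of `M / T(M)` in its injective envelope `E`: the largest submodule of `E` which
contains `M / T(M)` and whose quotient by `M / T(M)` is torsion. -/
noncomputable def quotientsSubmodule :
    Submodule A (InjectiveEnvelope A (M ⧸ F.torsionSubmodule M)) :=
  (F.torsionSubmodule (_ ⧸ F.envelopeBase M)).comap (F.envelopeBase M).mkQ

/-- The module of quotients `M_F`. -/
abbrev ModuleOfQuotients : Type (max u v) := F.quotientsSubmodule M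

theorem mem_quotientsSubmodule {x : InjectiveEnvelope A (M ⧸ F.torsionSubmodule M)} :
    x ∈ F.quotientsSubmodule M ↔ ∃ L ∈ F, ∀ a ∈ L, a • x ∈ F.envelopeBase M := by
  change (∃ L ∈ F, ∀ a ∈ L, a • (F.envelopeBase M).mkQ x = 0) ↔ _
  simp only [Submodule.mkQ_apply, ← Submodule.Quotient.mk_smul, Submodule.Quotient.mk_eq_zero]

theorem envelopeBase_le : F.envelopeBase M ≤ F.quotientsSubmodule M := by
  intro x hx
  obtain ⟨L, hL⟩ := F.nonempty
  exact (F.mem_quotientsSubmodule M).2 ⟨L, hL, fun a _ => Submodule.smul_mem _ a hx⟩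

/-- The natural map `q_M : M → M / T(M) → M_F`. -/
noncomputable def toQuotients : M →ₗ[A] F.ModuleOfQuotients M :=
  LinearMap.codRestrict (F.quotientsSubmodule M)
    (InjectiveEnvelope.ι A (M ⧸ F.torsionSubmodule M) ∘ₗ (F.torsionSubmodule M).mkQ)
    (fun x => F.envelopeBase_le M ⟨(F.torsionSubmodule M).mkQ x, rfl⟩)

/-- The envelope of `M / T(M)`, hence also `M_F`, is torsion-free. -/
theorem eq_zero_of_smul_eq_zero {L : Ideal A} (hL : L ∈ F)
    (x : InjectiveEnvelope A (M ⧸ F.torsionSubmodule M)) (hx : ∀ a ∈ L, a • x = 0) : x = 0 := by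
  by_contra h0
  obtain ⟨b, hb0, y, hy⟩ := (Submodule.isEssential_iff _).1
    (InjectiveEnvelope.isInjectiveEnvelope A (M ⧸ F.torsionSubmodule M)).essential x h0
  obtain ⟨m, rfl⟩ := (F.torsionSubmodule M).mkQ_surjective y
  have hm : ∀ a ∈ L.colon {b}, a • m ∈ F.torsionSubmodule M := by
    intro a ha
    have h1 : (a * b) • x = 0 := hx _ (by simpa using ha)
    rw [mul_smul, ← hy, ← map_smul, ← map_smul] at h1
    have h2 := (InjectiveEnvelope.isInjectiveEnvelope A (M ⧸ F.torsionSubmodule M)).mono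
      (h1.trans (map_zero _).symm)
    exact (Submodule.Quotient.mk_eq_zero _).1 h2
  have hmt : m ∈ F.torsionSubmodule M := by
    refine (F.isTorsionElem_iff m).2 (IsGabriel.gabriel_closed _
      ⟨L.colon {b}, IsUniform.colon_mem hL b, fun a ha => ?_⟩)
    refine Order.PFilter.mem_of_le ?_ ((F.isTorsionElem_iff (a • m)).1 (hm a ha))
    intro c hc
    simpa [mul_smul] using hc
  have : (F.torsionSubmodule M).mkQ m = 0 := by simpa using hmt
  rw [this, map_zero] at hy
  exact hb0 hy.symm

variable {F} {F₂ : IdealFilter A} [F₂.IsGabriel]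

theorem torsionSubmodule_mono (h : F ≤ F₂) : F.torsionSubmodule M ≤ F₂.torsionSubmodule M := by
  rintro x ⟨L, hL, hx⟩
  exact ⟨L, h hL, hx⟩

theorem exists_envelope_extension (h : F ≤ F₂) :
    ∃ g : InjectiveEnvelope A (M ⧸ F.torsionSubmodule M) →ₗ[A]
        InjectiveEnvelope A (M ⧸ F₂.torsionSubmodule M),
      g ∘ₗ InjectiveEnvelope.ι A (M ⧸ F.torsionSubmodule M) =
        InjectiveEnvelope.ι A (M ⧸ F₂.torsionSubmodule M) ∘ₗ
          Submodule.factor (torsionSubmodule_mono M h) :=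
  Module.Injective.extension_property A _ _ _ _
    (InjectiveEnvelope.isInjectiveEnvelope A (M ⧸ F.torsionSubmodule M)).mono _

/-- The map `q₁₂ : M_{F₁} → M_{F₂}` induced by an inclusion `F₁ ⊆ F₂`: the restriction of an
extension to the injective envelopes of the projection `M / T₁(M) → M / T₂(M)`. It does not depend
on the chosen extension: see `quotientsMap_comp` and `quotientsMap_unique`. -/
noncomputable def quotientsMap (h : F ≤ F₂) :
    F.ModuleOfQuotients M →ₗ[A] F₂.ModuleOfQuotients M :=
  LinearMap.restrict (exists_envelope_extension M h).choose (by
    intro x hx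
    obtain ⟨L, hL, hLx⟩ := (F.mem_quotientsSubmodule M).1 hx
    refine (F₂.mem_quotientsSubmodule M).2 ⟨L, h hL, fun a ha => ?_⟩
    obtain ⟨y, hy⟩ := hLx a ha
    rw [← map_smul, ← hy]
    exact ⟨_, (LinearMap.congr_fun (exists_envelope_extension M h).choose_spec y).symm⟩)

theorem quotientsMap_comp (h : F ≤ F₂) :
    quotientsMap M h ∘ₗ F.toQuotients M = F₂.toQuotients M := by
  ext m
  exact LinearMap.congr_fun (exists_envelope_extension M h).choose_spec
    ((F.torsionSubmodule M).mkQ m)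

theorem quotientsMap_unique (h : F ≤ F₂) (g : F.ModuleOfQuotients M →ₗ[A] F₂.ModuleOfQuotients M)
    (hg : g ∘ₗ F.toQuotients M = F₂.toQuotients M) : g = quotientsMap M h := by
  ext x : 1
  obtain ⟨L, hL, hLx⟩ := (F.mem_quotientsSubmodule M).1 x.2
  rw [← sub_eq_zero]
  refine Subtype.ext (F₂.eq_zero_of_smul_eq_zero M (h hL) _ fun a ha => ?_)
  obtain ⟨y, hy⟩ := hLx a ha
  obtain ⟨m, rfl⟩ := (F.torsionSubmodule M).mkQ_surjective y
  have hm : a • x = F.toQuotients M m := Subtype.ext hy.symm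
  have h1 : a • g x = a • quotientsMap M h x := by
    rw [← map_smul, ← map_smul, hm, ← LinearMap.comp_apply, ← LinearMap.comp_apply, hg,
      quotientsMap_comp]
  have h2 : a • (g x - quotientsMap M h x) = 0 := by rw [smul_sub, h1, sub_self]
  exact congrArg Subtype.val h2

end IdealFilter

/-! ### Torsion theories -/

/-- A torsion theory: a pair of classes of modules, each of which is maximal with respect to
`Hom(T, F) = 0` for `T` torsion and `F` torsion-free. -/
structure TorsionTheory (A : Type u) [Ring A] where
  IsTorsion : ∀ (M : Type u) [AddCommGroup M] [Module A M], Prop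
  IsTorsionFree : ∀ (M : Type u) [AddCommGroup M] [Module A M], Prop
  isTorsion_iff : ∀ (M : Type u) [AddCommGroup M] [Module A M], IsTorsion M ↔
    ∀ (N : Type u) [AddCommGroup N] [Module A N], IsTorsionFree N → ∀ f : M →ₗ[A] N, f = 0
  isTorsionFree_iff : ∀ (N : Type u) [AddCommGroup N] [Module A N], IsTorsionFree N ↔
    ∀ (M : Type u) [AddCommGroup M] [Module A M], IsTorsion M → ∀ f : M →ₗ[A] N, f = 0

/-- A torsion theory is hereditary if submodules of torsion modules are torsion. -/
structure HereditaryTorsionTheory (A : Type u) [Ring A] extends TorsionTheory A where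
  hereditary : ∀ (M : Type u) [AddCommGroup M] [Module A M] (N : Submodule A M),
    IsTorsion M → IsTorsion N

namespace TorsionTheory

variable {A : Type u} [Ring A] (τ : TorsionTheory A)

/-- The largest torsion submodule `T(M)`: the sum of all torsion submodules. -/
def torsionPart (M : Type u) [AddCommGroup M] [Module A M] : Submodule A M :=
  sSup {N : Submodule A M | τ.IsTorsion N}

/-- A torsion theory is faithful if `T(A) = 0`. -/
def IsFaithful : Prop := τ.torsionPart A = ⊥

end TorsionTheory

namespace HereditaryTorsionTheory

variable {A : Type u} [Ring A] (τ : HereditaryTorsionTheory A)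

theorem isTorsion_of_injective {M N : Type u} [AddCommGroup M] [Module A M] [AddCommGroup N]
    [Module A N] (g : M →ₗ[A] N) (hg : Function.Injective g) (hN : τ.IsTorsion N) :
    τ.IsTorsion M := by
  have h := (τ.isTorsion_iff _).1 (τ.hereditary N (LinearMap.range g) hN)
  refine (τ.isTorsion_iff M).2 fun P _ _ hP f => ?_
  have h0 := h P hP (f ∘ₗ (LinearEquiv.ofInjective g hg).symm.toLinearMap)
  ext x
  simpa using LinearMap.congr_fun h0 (LinearEquiv.ofInjective g hg x)

/-- The map `A ⧸ (I : a) → A ⧸ I` induced by right multiplication by `a`. -/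
theorem exists_colon_map (I : Ideal A) (a : A) :
    ∃ g : (A ⧸ I.colon {a}) →ₗ[A] (A ⧸ I), Function.Injective g ∧
      ∀ b : A, g (Submodule.Quotient.mk b) = Submodule.Quotient.mk (b * a) := by
  refine ⟨Submodule.mapQ _ _ (LinearMap.toSpanSingleton A A a)
    (fun b hb => by simpa using hb), ?_, fun b => rfl⟩
  rw [← LinearMap.ker_eq_bot, LinearMap.ker_eq_bot']
  intro x hx
  obtain ⟨b, rfl⟩ := Submodule.Quotient.mk_surjective _ x
  have : (Submodule.Quotient.mk (b * a) : A ⧸ I) = 0 := hx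
  rw [Submodule.Quotient.mk_eq_zero] at this ⊢
  simpa using this

theorem colon_mem (I : Ideal A) (hI : τ.IsTorsion (A ⧸ I)) (a : A) :
    τ.IsTorsion (A ⧸ I.colon {a}) := by
  obtain ⟨g, hg, -⟩ := exists_colon_map I a
  exact τ.isTorsion_of_injective g hg hI

theorem gabriel_mem (I J : Ideal A) (hJ : τ.IsTorsion (A ⧸ J))
    (h : ∀ a ∈ J, τ.IsTorsion (A ⧸ I.colon {a})) : τ.IsTorsion (A ⧸ I) := by
  refine (τ.isTorsion_iff _).2 fun N _ _ hN f => ?_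
  have h1 : ∀ a ∈ J, f (Submodule.Quotient.mk a) = 0 := by
    intro a ha
    obtain ⟨g, -, hg⟩ := exists_colon_map I a
    have h2 := (τ.isTorsion_iff _).1 (h a ha) N hN (f ∘ₗ g)
    have h3 := LinearMap.congr_fun h2 (Submodule.Quotient.mk 1)
    rw [LinearMap.comp_apply, hg, one_mul] at h3
    exact h3
  have h4 := (τ.isTorsion_iff _).1 hJ N hN (Submodule.liftQ J (f ∘ₗ I.mkQ) (fun a ha => h1 a ha))
  ext
  exact LinearMap.congr_fun h4 (Submodule.Quotient.mk 1)

theorem top_mem : τ.IsTorsion (A ⧸ (⊤ : Ideal A)) := by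
  refine (τ.isTorsion_iff _).2 fun N _ _ _ f => ?_
  ext
  have : (Submodule.Quotient.mk (1 : A) : A ⧸ (⊤ : Ideal A)) = 0 := by
    rw [Submodule.Quotient.mk_eq_zero]; trivial
  change f (Submodule.Quotient.mk 1) = 0
  rw [this, map_zero]

/-- The filter `{I | A / I is torsion}` of a hereditary torsion theory. -/
def filter : IdealFilter A :=
  (Order.IsPFilter.of_def (F := {I : Ideal A | τ.IsTorsion (A ⧸ I)}) ⟨⊤, τ.top_mem⟩
    (fun I hI J hJ => ⟨I ⊓ J, τ.gabriel_mem _ I hI fun a ha => by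
      have : (I ⊓ J).colon {a} = J.colon {a} := by
        ext b
        simp only [Submodule.mem_colon_singleton, Submodule.mem_inf, and_iff_right_iff_imp]
        exact fun _ => I.smul_mem b ha
      change τ.IsTorsion _
      rw [this]
      exact τ.colon_mem J hJ a, inf_le_left, inf_le_right⟩)
    (fun {I J} hIJ hI => τ.gabriel_mem J I hI fun a ha => by
      have : J.colon {a} = ⊤ := by
        ext b
        simpa using J.smul_mem b (hIJ ha)
      rw [this]
      exact τ.top_mem)).toPFilter

theorem mem_filter (I : Ideal A) : I ∈ τ.filter ↔ τ.IsTorsion (A ⧸ I) := Iff.rfl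

instance : τ.filter.IsGabriel where
  colon_mem hI a := τ.colon_mem _ hI a
  gabriel_closed I := fun ⟨J, hJ, h⟩ => τ.gabriel_mem I J hJ h

/-- The Lambek torsion theory, cogenerated by the injective envelope of the ring: `M` is torsion
iff `Hom(M, E(A)) = 0`. -/
def lambek (A : Type u) [Ring A] : HereditaryTorsionTheory A where
  IsTorsion M _ _ := ∀ f : M →ₗ[A] InjectiveEnvelope A A, f = 0
  IsTorsionFree N _ _ := ∀ (M : Type u) [AddCommGroup M] [Module A M],
    (∀ f : M →ₗ[A] InjectiveEnvelope A A, f = 0) → ∀ f : M →ₗ[A] N, f = 0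
  isTorsion_iff M _ _ := ⟨fun h _ _ _ hN f => hN M h f, fun h f => h _ (fun _ _ _ h' => h') f⟩
  isTorsionFree_iff _ _ _ := Iff.rfl
  hereditary M _ _ N hM f := by
    obtain ⟨g, hg⟩ := Module.Injective.extension_property A (InjectiveEnvelope A A) N M
      N.subtype N.injective_subtype f
    rw [← hg, hM g, LinearMap.zero_comp]

end HereditaryTorsionTheory

/-- A module is nonsingular if no nonzero element has an essential annihilator. -/
def IsNonsingularModule (A : Type u) [Ring A] (M : Type v) [AddCommGroup M] [Module A M] : Prop :=
  ∀ m : M, ((⊥ : Submodule A M).colon {m}).IsEssential → m = 0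

theorem IsNonsingularModule.envelope {A : Type u} [Ring A] {N : Type v} [AddCommGroup N]
    [Module A N] (hN : IsNonsingularModule A N) :
    IsNonsingularModule A (InjectiveEnvelope A N) := by
  intro x hx
  by_contra h0
  have hE := InjectiveEnvelope.isInjectiveEnvelope A N
  obtain ⟨b, hb0, n, hn⟩ := (Submodule.isEssential_iff _).1 hE.essential x h0
  have : n = 0 := by
    apply hN
    rw [Submodule.isEssential_iff] at hx ⊢
    have key : ∀ c : A, c • n = 0 ↔ (c * b) • x = 0 := by
      intro c
      rw [mul_smul, ← hn, ← map_smul, map_eq_zero_iff _ hE.mono]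
    intro a ha
    by_cases hab : a * b = 0
    · refine ⟨1, by simpa using ha, ?_⟩
      simp [key, hab]
    · obtain ⟨c, hc0, hc⟩ := hx (a * b) hab
      refine ⟨c, fun h => hc0 ?_, ?_⟩
      · simp only [smul_eq_mul] at h ⊢
        rw [← mul_assoc, h, zero_mul]
      · simpa [key, mul_assoc] using hc
  rw [this, map_zero] at hn
  exact hb0 hn.symm

/-- The Goldie torsion theory, whose torsion-free modules are the nonsingular modules. -/
def HereditaryTorsionTheory.goldie (A : Type u) [Ring A] : HereditaryTorsionTheory A where
  IsTorsion M _ _ := ∀ (N : Type u) [AddCommGroup N] [Module A N], IsNonsingularModule A N →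
    ∀ f : M →ₗ[A] N, f = 0
  IsTorsionFree N _ _ := IsNonsingularModule A N
  isTorsion_iff _ _ _ := Iff.rfl
  isTorsionFree_iff N _ _ := by
    refine ⟨fun hN M _ _ hM f => hM N hN f, fun h n hn => ?_⟩
    let I : Ideal A := (⊥ : Submodule A N).colon {n}
    let g : (A ⧸ I) →ₗ[A] N :=
      Submodule.liftQ I (LinearMap.toSpanSingleton A N n) (fun a ha => by simpa [I] using ha)
    have hg : g = 0 := by
      refine h (A ⧸ I) (fun P _ _ hP f => ?_) g
      ext
      refine hP _ ?_
      rw [Submodule.isEssential_iff] at hn ⊢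
      intro a ha
      obtain ⟨c, hc0, hc⟩ := hn a ha
      refine ⟨c, hc0, ?_⟩
      rw [Submodule.mem_colon_singleton]
      change (c • a) • f (Submodule.Quotient.mk 1) = 0
      rw [← map_smul, ← Submodule.Quotient.mk_smul, smul_eq_mul, mul_one,
        (Submodule.Quotient.mk_eq_zero I).2 hc, map_zero]
    simpa [g] using LinearMap.congr_fun hg (Submodule.Quotient.mk 1)
  hereditary M _ _ K hM N _ _ hN f := by
    obtain ⟨g, hg⟩ := Module.Injective.extension_property A (InjectiveEnvelope A N) K M
      K.subtype K.injective_subtype (InjectiveEnvelope.ι A N ∘ₗ f)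
    rw [hM _ hN.envelope g, LinearMap.zero_comp] at hg
    ext x
    exact (InjectiveEnvelope.isInjectiveEnvelope A N).mono
      ((LinearMap.congr_fun hg x).symm.trans (map_zero _).symm)

/-! ### Higher derivations -/

/-- A higher derivation `Δ = {δₙ}` on a ring `R`. -/
structure HigherDerivation (R : Type u) [Ring R] where
  δ : ℕ → R →+ R
  zero_eq : δ 0 = AddMonoidHom.id R
  map_mul : ∀ (n : ℕ) (r s : R),
    δ n (r * s) = ∑ i ∈ Finset.range (n + 1), δ i r * δ (n - i) s

/-- A `Δ`-higher derivation `D = {dₙ}` on a right `R`-module `M`: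
`dₙ(m r) = ∑_{i ≤ n} dᵢ(m) δₙ₋ᵢ(r)` and `d₀ = id`. -/
structure HigherDerivation.OnModule {R : Type u} [Ring R] (Δ : HigherDerivation R) (M : Type v)
    [AddCommGroup M] [Module Rᵐᵒᵖ M] where
  d : ℕ → M →+ M
  zero_eq : d 0 = AddMonoidHom.id M
  map_smul : ∀ (n : ℕ) (m : M) (r : R), d n (MulOpposite.op r • m) =
    ∑ i ∈ Finset.range (n + 1), MulOpposite.op (Δ.δ (n - i) r) • d i m

namespace HigherDerivation.OnModule

variable {R : Type u} [Ring R] {Δ : HigherDerivation R} {M : Type v} [AddCommGroup M]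
  [Module Rᵐᵒᵖ M]

/-- `D'` on `M_F` extends `D` on `M`: `d'ₙ q_M = q_M dₙ` for all `n`. -/
def IsExtension (F : IdealFilter Rᵐᵒᵖ) [F.IsGabriel] (D : Δ.OnModule M)
    (D' : Δ.OnModule (F.ModuleOfQuotients M)) : Prop :=
  ∀ (n : ℕ) (m : M), D'.d n (F.toQuotients M m) = F.toQuotients M (D.d n m)

/-- The extensions of `D` to `M_{F₁}` and `M_{F₂}` agree: `D` has a unique extension to each of the
two modules of quotients, and these extensions commute with `q₁₂ : M_{F₁} → M_{F₂}`. -/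
def ExtensionsAgree {F₁ F₂ : IdealFilter Rᵐᵒᵖ} [F₁.IsGabriel] [F₂.IsGabriel] (h : F₁ ≤ F₂)
    (D : Δ.OnModule M) : Prop :=
  (∃! D₁ : Δ.OnModule (F₁.ModuleOfQuotients M), D.IsExtension F₁ D₁) ∧
  (∃! D₂ : Δ.OnModule (F₂.ModuleOfQuotients M), D.IsExtension F₂ D₂) ∧
  ∀ (D₁ : Δ.OnModule (F₁.ModuleOfQuotients M)) (D₂ : Δ.OnModule (F₂.ModuleOfQuotients M)),
    D.IsExtension F₁ D₁ → D.IsExtension F₂ D₂ →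
    ∀ (n : ℕ) (x : F₁.ModuleOfQuotients M),
      IdealFilter.quotientsMap M h (D₁.d n x) = D₂.d n (IdealFilter.quotientsMap M h x)

end HigherDerivation.OnModule

/-!
For a higher derivation `Δ`, let `r : R` act on formal series `N⟦t⟧` with coefficients in `N` as
multiplication by `∑ δₙ(r) tⁿ`. A `Δ`-higher derivation on `N` is then the same as a linear section
`x ↦ ∑ dₙ(x) tⁿ` of the constant coefficient `N⟦t⟧ → N`. Modules of quotients are torsion-free and
`F`-injective, and both properties pass from `N` to `N⟦t⟧`, coefficient by coefficient. So the
universal property of `q : M → M_F` extends `m ↦ ∑ q(dₙ m) tⁿ` uniquely to `M_F`. Torsion-freeness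
of `M_{F₂}⟦t⟧` with respect to `F₁ ⊆ F₂` gives the agreement of the extensions. If `τ` is faithful,
then the ring, its injective envelope and all nonsingular modules are torsion-free for `F_τ`, which
is the comparison with the Lambek and Goldie filters.
-/

section FilterTorsion

variable {A : Type u} [Ring A] {F : IdealFilter A}
  {M : Type*} [AddCommGroup M] [Module A M] {N : Type*} [AddCommGroup N] [Module A N]
  {E : Type w} [AddCommGroup E] [Module A E] {Q : Type*} [AddCommGroup Q] [Module A Q]

/-- A module is torsion-free with respect to a filter `F` of ideals if no nonzero element of it is
annihilated by a member of `F`. -/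
def IsFilterTorsionFree (F : IdealFilter A) (N : Type*) [AddCommGroup N] [Module A N] : Prop :=
  ∀ x : N, F.IsTorsionElem x → x = 0

/-- A module `N` is `F`-injective if every linear map `L → N` on a member `L` of `F` extends to the
ring. The extension is encoded by the image `y` of `1`. -/
def IsFilterInjective (F : IdealFilter A) (N : Type*) [AddCommGroup N] [Module A N] : Prop :=
  ∀ L ∈ F, ∀ f : L →ₗ[A] N, ∃ y : N, ∀ a : L, f a = (a : A) • y

theorem exists_comp_eq_of_ker_le_ker [Small.{w} A] [Module.Injective A E] {q : M →ₗ[A] Q}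
    {g : M →ₗ[A] E} (hle : LinearMap.ker q ≤ LinearMap.ker g) :
    ∃ f : Q →ₗ[A] E, f ∘ₗ q = g := by
  obtain ⟨f, hf⟩ := Module.Injective.extension_property A E (M ⧸ LinearMap.ker q) Q
    ((LinearMap.ker q).liftQ q le_rfl)
    (LinearMap.ker_eq_bot.1 (Submodule.ker_liftQ_eq_bot' _ q rfl))
    ((LinearMap.ker q).liftQ g hle)
  refine ⟨f, ?_⟩
  rw [← Submodule.liftQ_mkQ _ q le_rfl, ← LinearMap.comp_assoc, hf, Submodule.liftQ_mkQ]

theorem exists_comp_eq_of_range_le_range {ι : N →ₗ[A] E} (hι : Function.Injective ι)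
    {g : M →ₗ[A] E} (hle : LinearMap.range g ≤ LinearMap.range ι) :
    ∃ f : M →ₗ[A] N, ι ∘ₗ f = g := by
  let e := LinearEquiv.ofInjective ι hι
  let g' : M →ₗ[A] LinearMap.range ι := g.codRestrict _ fun m => hle ⟨m, rfl⟩
  refine ⟨e.symm ∘ₗ g', ?_⟩
  ext m
  exact congrArg Subtype.val (e.apply_symm_apply (g' m))

theorem isTorsionElem_smul [F.IsUniform] (a : A) {m : M} (hm : F.IsTorsionElem m) :
    F.IsTorsionElem (a • m) := by
  obtain ⟨L, hL, hLm⟩ := hm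
  refine ⟨L.colon {a}, IdealFilter.IsUniform.colon_mem hL a, fun b hb => ?_⟩
  rw [← mul_smul]
  exact hLm _ (by simpa using hb)

theorem isTorsion_quotient_of_mem [F.IsUniform] {I : Ideal A} (hI : I ∈ F) :
    F.IsTorsion (A ⧸ I) := by
  intro x
  obtain ⟨b, rfl⟩ := I.mkQ_surjective x
  have h1 : F.IsTorsionElem (I.mkQ 1) :=
    ⟨I, hI, fun a ha => by simpa [← Submodule.Quotient.mk_smul] using ha⟩
  simpa only [← map_smul, smul_eq_mul, mul_one] using isTorsionElem_smul b h1

theorem mem_torsionSubmodule_of_smul_mem [F.IsGabriel] {L : Ideal A} (hL : L ∈ F) {m : M}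
    (h : ∀ a ∈ L, a • m ∈ F.torsionSubmodule M) : m ∈ F.torsionSubmodule M := by
  refine (F.isTorsionElem_iff m).2 (IdealFilter.IsGabriel.gabriel_closed _ ⟨L, hL, fun a ha => ?_⟩)
  convert (F.isTorsionElem_iff (a • m)).1 (h a ha) using 1
  ext b
  simp [mul_smul]

theorem isFilterTorsionFree_quotient_iff {P : Submodule A M} :
    IsFilterTorsionFree F (M ⧸ P) ↔ ∀ L ∈ F, ∀ x : M, (∀ a ∈ L, a • x ∈ P) → x ∈ P := by
  have hsmul (a : A) (x : M) : a • P.mkQ x = 0 ↔ a • x ∈ P := by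
    rw [← map_smul, Submodule.mkQ_apply, Submodule.Quotient.mk_eq_zero]
  have hzero (x : M) : P.mkQ x = 0 ↔ x ∈ P := by
    rw [Submodule.mkQ_apply, Submodule.Quotient.mk_eq_zero]
  rw [IsFilterTorsionFree, P.mkQ_surjective.forall]
  simp only [IdealFilter.IsTorsionElem, hsmul, hzero, forall_exists_index, and_imp]
  exact ⟨fun h L hL x hx => h x L hL hx, fun h x L hL hx => h L hL x hx⟩

namespace IsFilterTorsionFree

theorem anti {G : IdealFilter A} (h : F ≤ G) (hN : IsFilterTorsionFree G N) :
    IsFilterTorsionFree F N :=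
  fun x ⟨L, hL, hLx⟩ => hN x ⟨L, h hL, hLx⟩

theorem hom_eq_zero (hN : IsFilterTorsionFree F N) (hM : F.IsTorsion M) (f : M →ₗ[A] N) :
    f = 0 := by
  ext m
  obtain ⟨L, hL, hLm⟩ := hM m
  exact hN _ ⟨L, hL, fun a ha => by rw [← map_smul, hLm a ha, map_zero]⟩

theorem hom_ext (hN : IsFilterTorsionFree F N) {q : M →ₗ[A] Q}
    (hq : F.IsTorsion (Q ⧸ LinearMap.range q)) {f g : Q →ₗ[A] N} (h : f ∘ₗ q = g ∘ₗ q) :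
    f = g := by
  have hle : LinearMap.range q ≤ LinearMap.ker (f - g) := by
    rw [LinearMap.range_le_ker_iff, LinearMap.sub_comp, h, sub_self]
  have hzero : Submodule.liftQ _ (f - g) hle = 0 := hN.hom_eq_zero hq _
  rw [← sub_eq_zero, ← Submodule.liftQ_mkQ _ (f - g) hle, hzero, LinearMap.zero_comp]

theorem of_isEssential [F.IsUniform] (hN : IsFilterTorsionFree F N) {ι : N →ₗ[A] E}
    (hι : Function.Injective ι) (hess : (LinearMap.range ι).IsEssential) :
    IsFilterTorsionFree F E := by
  intro x hx
  by_contra hx0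
  obtain ⟨b, hb0, y, hy⟩ := (Submodule.isEssential_iff _).1 hess x hx0
  obtain ⟨L, hL, hLb⟩ := isTorsionElem_smul b hx
  have hy0 : y = 0 := hN y ⟨L, hL, fun a ha => hι (by rw [map_smul, hy, hLb a ha, map_zero])⟩
  exact hb0 (by rw [← hy, hy0, map_zero])

theorem quotient_range (hE : IsFilterTorsionFree F E) (hN : IsFilterInjective F N)
    {ι : N →ₗ[A] E} (hι : Function.Injective ι) :
    IsFilterTorsionFree F (E ⧸ LinearMap.range ι) := by
  refine isFilterTorsionFree_quotient_iff.2 fun L hL x hx => ?_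
  obtain ⟨f, hf⟩ : ∃ f : L →ₗ[A] N, ι ∘ₗ f = LinearMap.toSpanSingleton A E x ∘ₗ L.subtype := by
    refine exists_comp_eq_of_range_le_range hι ?_
    rintro _ ⟨a, rfl⟩
    exact hx a a.2
  obtain ⟨y, hy⟩ := hN L hL f
  have hyx : ∀ a ∈ L, a • (x - ι y) = 0 := fun a ha => by
    have hfa : ι (f ⟨a, ha⟩) = a • x := LinearMap.congr_fun hf ⟨a, ha⟩
    rw [smul_sub, ← hfa, hy, map_smul, sub_self]
  exact ⟨y, (sub_eq_zero.1 (hE _ ⟨L, hL, hyx⟩)).symm⟩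

theorem isEssential_of_mem [F.IsUniform] (hA : IsFilterTorsionFree F A) {I : Ideal A}
    (hI : I ∈ F) : I.IsEssential := by
  refine (Submodule.isEssential_iff I).2 fun a ha => ?_
  by_contra! hcon
  refine ha (hA a ⟨I.colon {a}, IdealFilter.IsUniform.colon_mem hI a, fun c hc => ?_⟩)
  by_contra hca
  exact hcon c hca (Submodule.mem_colon_singleton.1 hc)

end IsFilterTorsionFree

theorem IsFilterInjective.of_isFilterTorsionFree_quotient [Small.{w} A] [Module.Injective A E]
    {P : Submodule A E} (hP : IsFilterTorsionFree F (E ⧸ P)) : IsFilterInjective F P := by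
  intro L hL f
  obtain ⟨g, hg⟩ := Module.Injective.extension_property A E L A L.subtype L.injective_subtype
    (P.subtype ∘ₗ f)
  have hg1 (a : L) : (a : A) • g 1 = f a := by
    rw [← map_smul, smul_eq_mul, mul_one]
    exact LinearMap.congr_fun hg a
  have hmem : g 1 ∈ P := isFilterTorsionFree_quotient_iff.1 hP L hL _
    fun a ha => hg1 ⟨a, ha⟩ ▸ (f ⟨a, ha⟩).2
  exact ⟨⟨g 1, hmem⟩, fun a => Subtype.ext (hg1 a).symm⟩

theorem exists_comp_eq_of_isTorsion [F.IsUniform] {q : M →ₗ[A] Q}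
    (hker : F.IsTorsion (LinearMap.ker q)) (hcoker : F.IsTorsion (Q ⧸ LinearMap.range q))
    (hN : IsFilterTorsionFree F N) (hNinj : IsFilterInjective F N) (g : M →ₗ[A] N) :
    ∃ f : Q →ₗ[A] N, f ∘ₗ q = g := by
  let ι := InjectiveEnvelope.ι A N
  have hι : IsInjectiveEnvelope ι := InjectiveEnvelope.isInjectiveEnvelope A N
  have hle : LinearMap.ker q ≤ LinearMap.ker (ι ∘ₗ g) := by
    rw [LinearMap.ker_comp_of_ker_eq_bot g (LinearMap.ker_eq_bot.2 hι.mono)]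
    exact LinearMap.le_ker_iff_comp_subtype_eq_zero.2 (hN.hom_eq_zero hker _)
  obtain ⟨h, hh⟩ := exists_comp_eq_of_ker_le_ker hle
  have hquot : IsFilterTorsionFree F (_ ⧸ LinearMap.range ι) :=
    (hN.of_isEssential hι.mono hι.essential).quotient_range hNinj hι.mono
  have hmkQ : (LinearMap.range ι).mkQ ∘ₗ h = 0 := hquot.hom_ext hcoker <| by
    rw [LinearMap.comp_assoc, hh, ← LinearMap.comp_assoc, LinearMap.range_mkQ_comp,
      LinearMap.zero_comp, LinearMap.zero_comp]
  obtain ⟨f, hf⟩ : ∃ f : Q →ₗ[A] N, ι ∘ₗ f = h := by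
    refine exists_comp_eq_of_range_le_range hι.mono ?_
    rwa [← (LinearMap.range ι).ker_mkQ, LinearMap.range_le_ker_iff]
  refine ⟨f, (LinearMap.cancel_left hι.mono).1 ?_⟩
  rw [← LinearMap.comp_assoc, hf, hh]

end FilterTorsion

section ModuleOfQuotients

variable {A : Type u} [Ring A] (F : IdealFilter A) [F.IsGabriel]
  (M : Type v) [AddCommGroup M] [Module A M]

theorem isFilterTorsionFree_moduleOfQuotients :
    IsFilterTorsionFree F (F.ModuleOfQuotients M) :=
  fun x ⟨_, hL, hLx⟩ => Subtype.ext <|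
    F.eq_zero_of_smul_eq_zero M hL x fun a ha => congrArg Subtype.val (hLx a ha)

theorem isFilterInjective_moduleOfQuotients : IsFilterInjective F (F.ModuleOfQuotients M) :=
  .of_isFilterTorsionFree_quotient <| isFilterTorsionFree_quotient_iff.2
    fun _ hL _ hx => mem_torsionSubmodule_of_smul_mem hL hx

theorem isTorsion_ker_toQuotients : F.IsTorsion (LinearMap.ker (F.toQuotients M)) := by
  rintro ⟨m, hm⟩
  have hι : InjectiveEnvelope.ι A (M ⧸ F.torsionSubmodule M) ((F.torsionSubmodule M).mkQ m) = 0 :=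
    congrArg Subtype.val hm
  rw [map_eq_zero_iff _ (InjectiveEnvelope.isInjectiveEnvelope A _).mono, Submodule.mkQ_apply,
    Submodule.Quotient.mk_eq_zero] at hι
  obtain ⟨L, hL, hLm⟩ := hι
  exact ⟨L, hL, fun a ha => Subtype.ext (hLm a ha)⟩

theorem isTorsion_quotient_range_toQuotients :
    F.IsTorsion (F.ModuleOfQuotients M ⧸ LinearMap.range (F.toQuotients M)) := by
  intro y
  obtain ⟨x, rfl⟩ := (LinearMap.range (F.toQuotients M)).mkQ_surjective y
  obtain ⟨L, hL, hLx⟩ := (F.mem_quotientsSubmodule M).1 x.2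
  refine ⟨L, hL, fun a ha => ?_⟩
  rw [← map_smul, Submodule.mkQ_apply, Submodule.Quotient.mk_eq_zero]
  obtain ⟨z, hz⟩ := hLx a ha
  obtain ⟨m, rfl⟩ := (F.torsionSubmodule M).mkQ_surjective z
  exact ⟨m, Subtype.ext hz⟩

end ModuleOfQuotients

namespace HigherDerivation

open MulOpposite Finset

variable {R : Type u} [Ring R] {Δ : HigherDerivation R}

theorem δ_zero_apply (Δ : HigherDerivation R) (r : R) : Δ.δ 0 r = r := by
  rw [Δ.zero_eq, AddMonoidHom.id_apply]

theorem δ_apply_one_of_ne_zero (Δ : HigherDerivation R) {n : ℕ} (hn : n ≠ 0) : Δ.δ n 1 = 0 := by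
  obtain ⟨n, rfl⟩ := Nat.exists_eq_succ_of_ne_zero hn
  induction n using Nat.strong_induction_on with
  | _ n ih =>
    have hmiddle : ∑ i ∈ range n, Δ.δ (i + 1) 1 * Δ.δ (n + 1 - (i + 1)) 1 = 0 :=
      sum_eq_zero fun i hi => by rw [ih i (mem_range.1 hi) i.succ_ne_zero, zero_mul]
    have h := Δ.map_mul (n + 1) 1 1
    rw [mul_one, sum_range_succ, sum_range_succ', hmiddle] at h
    simpa [δ_zero_apply] using h

theorem δ_mul_eq_sum_antidiagonal (Δ : HigherDerivation R) (n : ℕ) (r s : R) :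
    Δ.δ n (r * s) = ∑ p ∈ antidiagonal n, Δ.δ p.1 r * Δ.δ p.2 s := by
  rw [Δ.map_mul, Finset.Nat.sum_antidiagonal_eq_sum_range_succ_mk]

/-- Formal series `∑ yₙ tⁿ` with coefficients in a right `R`-module `N`, on which `r : R` acts as
multiplication by `∑ δₙ(r) tⁿ`. They are encoded as sequences, in a type that remembers `Δ` because
the action depends on it. -/
def Series (_ : HigherDerivation R) (N : Type*) : Type _ := ℕ → N

namespace Series

variable {N : Type*} [AddCommGroup N]

instance : AddCommGroup (Δ.Series N) := inferInstanceAs (AddCommGroup (ℕ → N))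

/-- The `n`-th coefficient of a series. -/
def coeff (n : ℕ) : Δ.Series N →+ N := Pi.evalAddMonoidHom (fun _ => N) n

/-- The series with a given sequence of coefficients. -/
def mk (f : ℕ → N) : Δ.Series N := f

@[ext] theorem ext {x y : Δ.Series N} (h : ∀ n, coeff n x = coeff n y) : x = y := funext h

@[simp] theorem coeff_mk (f : ℕ → N) (n : ℕ) : coeff n (mk f : Δ.Series N) = f n := rfl

variable [Module Rᵐᵒᵖ N] {N' : Type*} [AddCommGroup N'] [Module Rᵐᵒᵖ N']

instance : SMul Rᵐᵒᵖ (Δ.Series N) where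
  smul a y := mk fun n => ∑ p ∈ antidiagonal n, op (Δ.δ p.2 a.unop) • coeff p.1 y

theorem coeff_smul (a : Rᵐᵒᵖ) (y : Δ.Series N) (n : ℕ) :
    coeff n (a • y) = ∑ p ∈ antidiagonal n, op (Δ.δ p.2 a.unop) • coeff p.1 y := rfl

protected theorem one_smul (y : Δ.Series N) : (1 : Rᵐᵒᵖ) • y = y := by
  ext n
  rw [coeff_smul, sum_eq_single (n, 0)]
  · simp [δ_zero_apply]
  · rintro ⟨i, j⟩ hij hne
    have hj : j ≠ 0 := by
      rintro rfl
      exact hne (by simpa using hij)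
    rw [unop_one, Δ.δ_apply_one_of_ne_zero hj, op_zero, zero_smul]
  · simp

protected theorem mul_smul (a b : Rᵐᵒᵖ) (y : Δ.Series N) : (a * b) • y = a • b • y := by
  ext n
  simp only [coeff_smul, unop_mul, δ_mul_eq_sum_antidiagonal, op_sum, op_mul, sum_smul, smul_sum,
    mul_smul]
  rw [sum_sigma', sum_sigma']
  -- Both sides are the sum of the `yᵢ δₖ(b) δₗ(a)` over all `i + k + l = n`.
  refine sum_nbij' (fun ⟨⟨i, _⟩, ⟨k, l⟩⟩ => ⟨(i + k, l), (i, k)⟩)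
    (fun ⟨⟨_, j⟩, ⟨k, l⟩⟩ => ⟨(k, l + j), (l, j)⟩) ?_ ?_ ?_ ?_ ?_
  all_goals
    rintro ⟨⟨i, j⟩, ⟨k, l⟩⟩ h
    simp only [mem_sigma, HasAntidiagonal.mem_antidiagonal] at h
    obtain ⟨rfl, rfl⟩ := h
    simp [add_assoc]

instance : Module Rᵐᵒᵖ (Δ.Series N) where
  one_smul := Series.one_smul
  mul_smul := Series.mul_smul
  smul_zero a := by ext n; simp [coeff_smul]
  smul_add a x y := by ext n; simp [coeff_smul, sum_add_distrib]
  add_smul a b y := by ext n; simp [coeff_smul, sum_add_distrib, add_smul]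
  zero_smul y := by ext n; simp [coeff_smul]

/-- The constant coefficient of a series, as a linear map. -/
def constantCoeff : Δ.Series N →ₗ[Rᵐᵒᵖ] N where
  __ := coeff 0
  map_smul' a y := by simp [coeff_smul, δ_zero_apply]

/-- The map induced on series by a linear map of the coefficients. -/
def map (f : N →ₗ[Rᵐᵒᵖ] N') : Δ.Series N →ₗ[Rᵐᵒᵖ] Δ.Series N' where
  toFun y := mk fun n => f (coeff n y)
  map_add' x y := by ext n; simp
  map_smul' a y := by ext n; simp [coeff_smul]

/-- The submodule of series of order at least `n`. -/
def orderGE (Δ : HigherDerivation R) (N : Type*) [AddCommGroup N] [Module Rᵐᵒᵖ N] (n : ℕ) :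
    Submodule Rᵐᵒᵖ (Δ.Series N) where
  carrier := {y | ∀ i < n, coeff i y = 0}
  zero_mem' _ _ := map_zero _
  add_mem' hx hy i hi := by rw [map_add, hx i hi, hy i hi, add_zero]
  smul_mem' a y hy i hi := by
    rw [coeff_smul]
    exact sum_eq_zero fun p hp => by
      rw [hy p.1 ((HasAntidiagonal.antidiagonal.fst_le hp).trans_lt hi), smul_zero]

theorem eq_zero_of_forall_mem_orderGE {y : Δ.Series N} (h : ∀ n, y ∈ orderGE Δ N n) : y = 0 :=
  ext fun n => h (n + 1) n n.lt_succ_self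

/-- The `n`-th coefficient on series of order at least `n`, where it is linear. -/
def leadingCoeff (n : ℕ) : orderGE Δ N n →ₗ[Rᵐᵒᵖ] N where
  __ := (coeff n).comp (orderGE Δ N n).subtype.toAddMonoidHom
  map_smul' a y := by
    change coeff n (a • (y : Δ.Series N)) = a • coeff n (y : Δ.Series N)
    rw [coeff_smul, sum_eq_single (n, 0)]
    · simp [δ_zero_apply]
    · rintro ⟨i, j⟩ hij hne
      have hi : i < n := by grind [HasAntidiagonal.mem_antidiagonal]
      rw [y.2 i hi, smul_zero]
    · simp

theorem leadingCoeff_surjective (n : ℕ) :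
    Function.Surjective (leadingCoeff n : orderGE Δ N n →ₗ[Rᵐᵒᵖ] N) :=
  fun z => ⟨⟨mk (Pi.single n z), fun i hi => by simp [hi.ne]⟩,
    Pi.single_eq_same (M := fun _ => N) n z⟩

theorem coe_mem_orderGE_succ {n : ℕ} {y : orderGE Δ N n} :
    (y : Δ.Series N) ∈ orderGE Δ N (n + 1) ↔ leadingCoeff n y = 0 := by
  refine ⟨fun h => h n n.lt_succ_self, fun h i hi => ?_⟩
  obtain hi | rfl := Nat.lt_succ_iff_lt_or_eq.1 hi
  · exact y.2 i hi
  · exact h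

variable {F : IdealFilter Rᵐᵒᵖ}

theorem isFilterTorsionFree_quotient_orderGE (hN : IsFilterTorsionFree F N) (n : ℕ) :
    IsFilterTorsionFree F (Δ.Series N ⧸ orderGE Δ N n) := by
  refine isFilterTorsionFree_quotient_iff.2 fun L hL x hx => ?_
  induction n with
  | zero => exact fun i hi => absurd hi i.not_lt_zero
  | succ n ih =>
    have hxn : x ∈ orderGE Δ N n := ih fun a ha i hi => hx a ha i (hi.trans n.lt_succ_self)
    refine coe_mem_orderGE_succ (y := ⟨x, hxn⟩).2 (hN _ ⟨L, hL, fun a ha => ?_⟩)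
    rw [← map_smul]
    exact coe_mem_orderGE_succ.1 (hx a ha)

theorem isFilterTorsionFree (hN : IsFilterTorsionFree F N) :
    IsFilterTorsionFree F (Δ.Series N) := by
  rintro x ⟨L, hL, hLx⟩
  refine eq_zero_of_forall_mem_orderGE fun n => ?_
  refine isFilterTorsionFree_quotient_iff.1 (isFilterTorsionFree_quotient_orderGE hN n) L hL x ?_
  exact fun a ha => hLx a ha ▸ zero_mem _

theorem exists_sub_smul_mem_orderGE (hN : IsFilterInjective F N) {L : Ideal Rᵐᵒᵖ} (hL : L ∈ F)
    (f : L →ₗ[Rᵐᵒᵖ] Δ.Series N) (n : ℕ) :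
    ∃ y : Δ.Series N, ∀ a : L, f a - (a : Rᵐᵒᵖ) • y ∈ orderGE Δ N n := by
  induction n with
  | zero => exact ⟨0, fun a i hi => absurd hi i.not_lt_zero⟩
  | succ n ih =>
    obtain ⟨y, hy⟩ := ih
    let g : L →ₗ[Rᵐᵒᵖ] orderGE Δ N n :=
      (f - LinearMap.toSpanSingleton Rᵐᵒᵖ _ y ∘ₗ L.subtype).codRestrict _ hy
    obtain ⟨z, hz⟩ := hN L hL (leadingCoeff n ∘ₗ g)
    obtain ⟨w, rfl⟩ := leadingCoeff_surjective (Δ := Δ) n z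
    refine ⟨y + w, fun a => ?_⟩
    have hlead : leadingCoeff n (g a - (a : Rᵐᵒᵖ) • w) = 0 := by
      rw [map_sub, map_smul, sub_eq_zero]
      exact hz a
    rw [smul_add, ← sub_sub]
    exact coe_mem_orderGE_succ.2 hlead

theorem exists_forall_sub_mem_orderGE {Y : ℕ → Δ.Series N}
    (hY : ∀ n m, n ≤ m → Y m - Y n ∈ orderGE Δ N n) :
    ∃ y : Δ.Series N, ∀ n, y - Y n ∈ orderGE Δ N n := by
  refine ⟨mk fun i => coeff i (Y (i + 1)), fun n i hi => ?_⟩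
  have h := hY (i + 1) n hi i i.lt_succ_self
  rw [map_sub, sub_eq_zero] at h ⊢
  rw [coeff_mk, h]

theorem isFilterInjective (hN : IsFilterTorsionFree F N) (hNinj : IsFilterInjective F N) :
    IsFilterInjective F (Δ.Series N) := by
  intro L hL f
  choose Y hY using exists_sub_smul_mem_orderGE hNinj hL f
  have hcauchy (n m : ℕ) (hnm : n ≤ m) : Y m - Y n ∈ orderGE Δ N n := by
    refine isFilterTorsionFree_quotient_iff.1 (isFilterTorsionFree_quotient_orderGE hN n) L hL _ ?_
    intro a ha
    have hm : f ⟨a, ha⟩ - a • Y m ∈ orderGE Δ N n :=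
      fun i hi => hY m ⟨a, ha⟩ i (hi.trans_le hnm)
    have hsub := sub_mem (hY n ⟨a, ha⟩) hm
    rwa [sub_sub_sub_cancel_left, ← smul_sub] at hsub
  obtain ⟨y, hy⟩ := exists_forall_sub_mem_orderGE hcauchy
  refine ⟨y, fun a => sub_eq_zero.1 (eq_zero_of_forall_mem_orderGE fun n => ?_)⟩
  have hsub := sub_mem (hY n a) ((orderGE Δ N n).smul_mem (a : Rᵐᵒᵖ) (hy n))
  rwa [smul_sub, sub_sub, add_sub_cancel] at hsub

end Series

namespace OnModule

variable {M : Type*} [AddCommGroup M] [Module Rᵐᵒᵖ M] {M' : Type*} [AddCommGroup M']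
  [Module Rᵐᵒᵖ M'] {Q : Type*} [AddCommGroup Q] [Module Rᵐᵒᵖ Q] {Q' : Type*} [AddCommGroup Q']
  [Module Rᵐᵒᵖ Q'] {F : IdealFilter Rᵐᵒᵖ}

@[ext] theorem ext {D D' : Δ.OnModule M} (h : ∀ n m, D.d n m = D'.d n m) : D = D' := by
  cases D
  cases D'
  congr
  funext n
  exact AddMonoidHom.ext (h n)

/-- The linear map `m ↦ ∑ dₙ(m) tⁿ` which encodes a higher derivation. -/
def toSeries (D : Δ.OnModule M) : M →ₗ[Rᵐᵒᵖ] Δ.Series M where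
  toFun m := Series.mk fun n => D.d n m
  map_add' x y := by ext n; simp
  map_smul' a m := by
    ext n
    rw [Series.coeff_smul, Finset.Nat.sum_antidiagonal_eq_sum_range_succ_mk]
    exact D.map_smul n m a.unop

/-- The higher derivation formed by the coefficients of a linear section of the constant
coefficient. -/
def ofSeries (f : M →ₗ[Rᵐᵒᵖ] Δ.Series M) (hf : Series.constantCoeff ∘ₗ f = LinearMap.id) :
    Δ.OnModule M where
  d n := (Series.coeff n).comp f.toAddMonoidHom
  zero_eq := AddMonoidHom.ext fun m => LinearMap.congr_fun hf m
  map_smul n m r := by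
    change Series.coeff n (f (op r • m)) = _
    rw [_root_.map_smul, Series.coeff_smul, Finset.Nat.sum_antidiagonal_eq_sum_range_succ_mk]
    rfl

/-- A linear map intertwines higher derivations `D` and `D'` on its source and target if it commutes
with all their components. For `f = q_F` this says that `D'` is an extension of `D`, and for
`f = q₁₂` that two extensions agree. -/
def Intertwines (D : Δ.OnModule M) (D' : Δ.OnModule M') (f : M →ₗ[Rᵐᵒᵖ] M') : Prop :=
  ∀ n m, D'.d n (f m) = f (D.d n m)

theorem intertwines_iff {D : Δ.OnModule M} {D' : Δ.OnModule M'} {f : M →ₗ[Rᵐᵒᵖ] M'} :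
    D.Intertwines D' f ↔ D'.toSeries ∘ₗ f = Series.map f ∘ₗ D.toSeries :=
  ⟨fun h => LinearMap.ext fun m => Series.ext fun n => h n m,
    fun h n m => congrArg (Series.coeff n) (LinearMap.congr_fun h m)⟩

theorem Intertwines.of_comp {D : Δ.OnModule M} {D₁ : Δ.OnModule Q} {D₂ : Δ.OnModule Q'}
    {q : M →ₗ[Rᵐᵒᵖ] Q} {g : Q →ₗ[Rᵐᵒᵖ] Q'} (hq : F.IsTorsion (Q ⧸ LinearMap.range q))
    (hQ' : IsFilterTorsionFree F Q') (h₁ : D.Intertwines D₁ q)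
    (h₂ : D.Intertwines D₂ (g ∘ₗ q)) : D₁.Intertwines D₂ g := by
  refine intertwines_iff.2 ((Series.isFilterTorsionFree hQ').hom_ext hq ?_)
  ext m n
  exact (h₂ n m).trans (congrArg g (h₁ n m)).symm

theorem exists_intertwines [F.IsUniform] {q : M →ₗ[Rᵐᵒᵖ] Q}
    (hker : F.IsTorsion (LinearMap.ker q)) (hcoker : F.IsTorsion (Q ⧸ LinearMap.range q))
    (hQ : IsFilterTorsionFree F Q) (hQinj : IsFilterInjective F Q) (D : Δ.OnModule M) :
    ∃ D' : Δ.OnModule Q, D.Intertwines D' q := by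
  obtain ⟨f, hf⟩ := exists_comp_eq_of_isTorsion hker hcoker (Series.isFilterTorsionFree hQ)
    (Series.isFilterInjective hQ hQinj) (Series.map q ∘ₗ D.toSeries)
  have hcoeff (n : ℕ) (m : M) : Series.coeff n (f (q m)) = q (D.d n m) :=
    congrArg (Series.coeff n) (LinearMap.congr_fun hf m)
  have hf0 : Series.constantCoeff ∘ₗ f = LinearMap.id := hQ.hom_ext hcoker <|
    LinearMap.ext fun m => (hcoeff 0 m).trans (by rw [D.zero_eq]; rfl)
  exact ⟨ofSeries f hf0, hcoeff⟩

theorem existsUnique_intertwines [F.IsUniform] {q : M →ₗ[Rᵐᵒᵖ] Q}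
    (hker : F.IsTorsion (LinearMap.ker q)) (hcoker : F.IsTorsion (Q ⧸ LinearMap.range q))
    (hQ : IsFilterTorsionFree F Q) (hQinj : IsFilterInjective F Q) (D : Δ.OnModule M) :
    ∃! D' : Δ.OnModule Q, D.Intertwines D' q :=
  existsUnique_of_exists_of_unique (exists_intertwines hker hcoker hQ hQinj D) fun _ _ h₁ h₂ =>
    (ext (Intertwines.of_comp (g := LinearMap.id) hcoker hQ h₁ h₂)).symm

theorem existsUnique_isExtension (F : IdealFilter Rᵐᵒᵖ) [F.IsGabriel] (D : Δ.OnModule M) :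
    ∃! D' : Δ.OnModule (F.ModuleOfQuotients M), D.IsExtension F D' :=
  D.existsUnique_intertwines (isTorsion_ker_toQuotients F M)
    (isTorsion_quotient_range_toQuotients F M) (isFilterTorsionFree_moduleOfQuotients F M)
    (isFilterInjective_moduleOfQuotients F M)

theorem extensionsAgree {F₁ F₂ : IdealFilter Rᵐᵒᵖ} [F₁.IsGabriel] [F₂.IsGabriel] (h : F₁ ≤ F₂)
    (D : Δ.OnModule M) : D.ExtensionsAgree h := by
  refine ⟨D.existsUnique_isExtension F₁, D.existsUnique_isExtension F₂, fun D₁ D₂ h₁ h₂ n x => ?_⟩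
  have h₂' : D.Intertwines D₂ (IdealFilter.quotientsMap M h ∘ₗ F₁.toQuotients M) := by
    rw [IdealFilter.quotientsMap_comp]
    exact h₂
  exact (Intertwines.of_comp (isTorsion_quotient_range_toQuotients F₁ M)
    ((isFilterTorsionFree_moduleOfQuotients F₂ M).anti h) h₁ h₂' n x).symm

end OnModule

end HigherDerivation

theorem IsNonsingularModule.isFilterTorsionFree {A : Type u} [Ring A] {F : IdealFilter A}
    [F.IsUniform] {N : Type*} [AddCommGroup N] [Module A N] (hN : IsNonsingularModule A N)
    (hA : IsFilterTorsionFree F A) : IsFilterTorsionFree F N :=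
  fun x hx => hN x (hA.isEssential_of_mem ((F.isTorsionElem_iff x).1 hx))

namespace TorsionTheory

variable {A : Type u} [Ring A] {τ : TorsionTheory A} {M N : Type u} [AddCommGroup M] [Module A M]
  [AddCommGroup N] [Module A N]

theorem isTorsion_of_surjective (hM : τ.IsTorsion M) {g : M →ₗ[A] N}
    (hg : Function.Surjective g) : τ.IsTorsion N := by
  refine (τ.isTorsion_iff N).2 fun P _ _ hP f => ?_
  rw [← LinearMap.cancel_right hg, LinearMap.zero_comp]
  exact (τ.isTorsion_iff M).1 hM P hP (f ∘ₗ g)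

theorem IsFaithful.hom_eq_zero (hτ : τ.IsFaithful) (hM : τ.IsTorsion M) (f : M →ₗ[A] A) :
    f = 0 := by
  have hle : LinearMap.range f ≤ τ.torsionPart A :=
    le_sSup (isTorsion_of_surjective hM f.surjective_rangeRestrict)
  rwa [hτ, le_bot_iff, LinearMap.range_eq_bot] at hle

end TorsionTheory

namespace HereditaryTorsionTheory

variable {A : Type u} [Ring A] {τ : HereditaryTorsionTheory A}

theorem isFilterTorsionFree_of_isFaithful (hτ : τ.IsFaithful) : IsFilterTorsionFree τ.filter A := by
  rintro x ⟨I, hI, hIx⟩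
  have h : I.liftQ (LinearMap.toSpanSingleton A A x) hIx = 0 :=
    hτ.hom_eq_zero ((τ.mem_filter I).1 hI) _
  have h1 : (1 : A) • x = 0 := LinearMap.congr_fun h (I.mkQ 1)
  rwa [one_smul] at h1

theorem filter_le_lambek (hτ : τ.IsFaithful) : τ.filter ≤ (lambek A).filter := by
  have hA : IsInjectiveEnvelope (InjectiveEnvelope.ι A A) :=
    InjectiveEnvelope.isInjectiveEnvelope A A
  have hE := (isFilterTorsionFree_of_isFaithful hτ).of_isEssential hA.mono hA.essential
  exact fun I hI => ((lambek A).mem_filter I).2 fun f =>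
    hE.hom_eq_zero (isTorsion_quotient_of_mem hI) f

theorem filter_le_goldie (hτ : τ.IsFaithful) : τ.filter ≤ (goldie A).filter :=
  fun I hI => ((goldie A).mem_filter I).2 fun _ _ _ hN f =>
    (hN.isFilterTorsionFree (isFilterTorsionFree_of_isFaithful hτ)).hom_eq_zero
      (isTorsion_quotient_of_mem hI) f

end HereditaryTorsionTheory

theorem mainTheorem4 {R : Type u} [Ring R] (Δ : HigherDerivation R) :
    (∀ (F₁ F₂ : IdealFilter Rᵐᵒᵖ) [F₁.IsGabriel] [F₂.IsGabriel] (h : F₁ ≤ F₂)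
      (M : Type v) [AddCommGroup M] [Module Rᵐᵒᵖ M] (D : Δ.OnModule M),
      D.ExtensionsAgree h) ∧
    (∀ τ : HereditaryTorsionTheory Rᵐᵒᵖ, τ.IsFaithful →
      (∃ h : τ.filter ≤ (HereditaryTorsionTheory.lambek Rᵐᵒᵖ).filter,
        ∀ (M : Type v) [AddCommGroup M] [Module Rᵐᵒᵖ M] (D : Δ.OnModule M),
          D.ExtensionsAgree h) ∧
      (∃ h : τ.filter ≤ (HereditaryTorsionTheory.goldie Rᵐᵒᵖ).filter,
        ∀ (M : Type v) [AddCommGroup M] [Module Rᵐᵒᵖ M] (D : Δ.OnModule M),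
          D.ExtensionsAgree h)) := by
  refine ⟨fun _ _ _ _ h _ _ _ D => D.extensionsAgree h, fun τ hτ => ⟨?lambek, ?goldie⟩⟩
  case lambek =>
    exact ⟨HereditaryTorsionTheory.filter_le_lambek hτ, fun _ _ _ D => D.extensionsAgree _⟩
  case goldie =>
    exact ⟨HereditaryTorsionTheory.filter_le_goldie hτ, fun _ _ _ D => D.extensionsAgree _⟩
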